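/- A set system $(V,\mathcal B)$ consists of a finite set $V$ of points and a family $\mathcal B$ of subsets of $V$, called blocks. It is an $S(2,k,v)$ (Steiner $2$-design) if $|V|=v$, every block has exactly $k$ points, and any two distinct points lie together in exactly one block. It is $r$-even-free if there is no set of $i$ blocks with $1\le i\le r$ such that every point lies in an even number (possibly zero) of these $i$ blocks. A set system with point set $\mathbb Z/v\mathbb Z$ is cyclic if $B+1$ is a block for every block $B$. A Singer cycle of $\mathrm{PG}(m,q)$ is a projectivity (a permutation of the points induced by an invertible linear map of $\mathbb F_q^{m+1}$) that permutes all the points in a single cycle. **Proposition.** Let $m\ge 3$ be an integer and $q$ an odd prime power, and put $v=\frac{q^{m+1}-1}{q-1}$. Then there exists a cyclic $(2q+1)$-even-free $S(2,q+1,v)$ with point set $\mathbb Z/v\mathbb Z$. Moreover, it can be chosen isomorphic to the set system of points and lines of $\mathrm{PG}(m,q)$, by a bijection from $\mathbb Z/v\mathbb Z$ to the points that carries the blocks exactly to the lines and the shift $i\mapsto i+1$ to a Singer cycle. -/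

import Mathlib

open scoped LinearAlgebra.Projectivization

/-- A set system whose point set is the type `V`, given by its family of blocks. Finiteness of the
point set is required where it is used, see `SetSystem.IsSteiner`. -/
structure SetSystem (V : Type*) where
  /-- The family of blocks. -/
  blocks : Set (Set V)

namespace SetSystem

/-- The set system is a Steiner 2-design `S(2,k,v)`: there are `v` points (finitely many), each
block has exactly `k` points, and any two distinct points lie together in exactly one block. -/
structure IsSteiner {V : Type*} (S : SetSystem V) (k v : ℕ) : Prop where
  finite : Finite V
  card_points : Nat.card V = v
  card_block : ∀ B ∈ S.blocks, B.ncard = k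
  existsUnique_block : ∀ a b : V, a ≠ b → ∃! B : Set V, B ∈ S.blocks ∧ a ∈ B ∧ b ∈ B

/-- `(W, C)` is an even configuration of the set system `S`: it is a set system with points and
blocks taken from `S`, and each point of `W` lies in an even number of the blocks in `C`. -/
structure IsEvenConfiguration {V : Type*} (S : SetSystem V) (W : Set V) (C : Set (Set V)) :
    Prop where
  subset_blocks : C ⊆ S.blocks
  block_subset : ∀ B ∈ C, B ⊆ W
  even : ∀ a ∈ W, Even {B | B ∈ C ∧ a ∈ B}.ncard

/-- `S` is `r`-even-free: for no positive `i ≤ r` does it contain an even configuration that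
consists of exactly `i` blocks. -/
def IsEvenFree {V : Type*} (S : SetSystem V) (r : ℕ) : Prop :=
  ∀ i : ℕ, 0 < i → i ≤ r →
    ¬ ∃ (W : Set V) (C : Set (Set V)), S.IsEvenConfiguration W C ∧ C.ncard = i

/-- A set system on the point set `ℤ/vℤ` is cyclic: the shift `B + 1` of any block `B` is again
a block. -/
def IsCyclic {v : ℕ} (S : SetSystem (ZMod v)) : Prop :=
  ∀ B ∈ S.blocks, (fun x : ZMod v => x + 1) '' B ∈ S.blocks

/-- The bijection `e` is an isomorphism of set systems: the images of the blocks of `S` are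
exactly the blocks of `T`. -/
def IsIso {V W : Type*} (S : SetSystem V) (T : SetSystem W) (e : V ≃ W) : Prop :=
  {L : Set W | ∃ B ∈ S.blocks, e '' B = L} = T.blocks

end SetSystem

/-- The set system of points and lines of the projective geometry `PG(m, F)`. Points are the
one-dimensional subspaces of `F ^ (m + 1)`; a line is the set of all points contained in a fixed
two-dimensional subspace. -/
def projectiveGeometry (F : Type*) [Field F] (m : ℕ) : SetSystem (ℙ F (Fin (m + 1) → F)) where
  blocks := {L | ∃ M : Submodule F (Fin (m + 1) → F),
    Module.finrank F M = 2 ∧ L = {p | p.submodule ≤ M}}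

/-- An invertible linear map of `F ^ (m + 1)` induces a Singer cycle of `PG(m, F)`: it permutes all
the points in a single cycle. -/
def IsSingerCycle {F : Type*} [Field F] {m : ℕ}
    (g : LinearMap.GeneralLinearGroup F (Fin (m + 1) → F)) : Prop :=
  (MulAction.toPerm g : Equiv.Perm (ℙ F (Fin (m + 1) → F))).IsCycleOn Set.univ

/-! Let C be a nonempty even family of lines. Two of its lines meet and span a plane P. If C lies in
P, any two lines of P meet, and counting incidences along a line gives |C| if it is not in C, |C| +
q if it is. Both sums are even and q is odd, so C contains every line of P and |C| > q² + q
(`lt_card_of_subset_plane`). Otherwise let n ≥ 2 be the number of lines of C in P. At least n(q + 2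
- n) lines of C leave P (`mul_le_card_outside`), and at least q + 1 do (`lt_card_outside`); together
these force |C| ≥ 2q + 2.

For cyclicity, identify F^(m+1) with the field K of q^(m+1) elements. Multiplication by a generator
ζ of Kˣ is a Singer cycle, and exponents modulo v label the points (`exists_singerCycle`). The
blocks are described by the equation a^q = a, not by an embedding of F, so one design serves every
field of order q. -/

namespace SetSystem

variable {V : Type*}

/-! ### Even families in Steiner systems with planes -/

/-- A set of points is a subspace of a set system if it contains every block that has two distinct
points in it. -/
def IsSubspace (S : SetSystem V) (P : Set V) : Prop :=
  ∀ D ∈ S.blocks, ∀ a ∈ D, ∀ b ∈ D, a ≠ b → a ∈ P → b ∈ P → D ⊆ P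

/-- Two distinct blocks that meet lie in a common subspace in which any two blocks meet. -/
def HasPlanes (S : SetSystem V) : Prop :=
  ∀ A ∈ S.blocks, ∀ B ∈ S.blocks, A ≠ B → (A ∩ B).Nonempty → ∃ P : Set V, A ⊆ P ∧ B ⊆ P ∧
    S.IsSubspace P ∧ ∀ D ∈ S.blocks, ∀ E ∈ S.blocks, D ⊆ P → E ⊆ P → (D ∩ E).Nonempty

theorem IsSteiner.block_eq {S : SetSystem V} {k v : ℕ} (hS : S.IsSteiner k v) {A B : Set V}
    (hA : A ∈ S.blocks) (hB : B ∈ S.blocks) {a b : V} (hab : a ≠ b)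
    (haA : a ∈ A) (hbA : b ∈ A) (haB : a ∈ B) (hbB : b ∈ B) : A = B :=
  (hS.existsUnique_block a b hab).unique ⟨hA, haA, hbA⟩ ⟨hB, haB, hbB⟩

open Finset Classical

/-- Every point of a block in an even family lies on a second block of the family. -/
theorem exists_ne_of_even {C : Finset (Set V)} {a : V} (h : Even #{B ∈ C | a ∈ B})
    {B : Set V} (hB : B ∈ C) (ha : a ∈ B) : ∃ D ∈ C, D ≠ B ∧ a ∈ D := by
  have hmem : B ∈ ({B ∈ C | a ∈ B} : Finset (Set V)) := by simp [hB, ha]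
  have hpos : 0 < #{B ∈ C | a ∈ B} := card_pos.2 ⟨B, hmem⟩
  have h1 : 1 < #{B ∈ C | a ∈ B} := by
    rcases h with ⟨r, hr⟩
    omega
  obtain ⟨D, hD, hne⟩ := exists_mem_ne h1 B
  rw [mem_filter] at hD
  exact ⟨D, hD.1, hne, hD.2⟩

section Finite

variable [Fintype V] {S : SetSystem V} {q v : ℕ}

theorem IsSteiner.card_toFinset (hS : S.IsSteiner (q + 1) v) {B : Set V}
    (hB : B ∈ S.blocks) : #B.toFinset = q + 1 := by
  rw [← hS.card_block B hB, Set.ncard_eq_toFinset_card']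

/-- An even family with `n ≥ 1` blocks inside a subspace `P` has at least `n * (q + 2 - n)` blocks
outside `P`. -/
theorem IsSteiner.mul_le_card_outside (hS : S.IsSteiner (q + 1) v) {C : Finset (Set V)}
    (hC : ∀ B ∈ C, B ∈ S.blocks) (heven : ∀ a, Even #{B ∈ C | a ∈ B}) {P : Set V}
    (hP : S.IsSubspace P) :
    #{B ∈ C | B ⊆ P} * (q + 2 - #{B ∈ C | B ⊆ P}) ≤ #{B ∈ C | ¬ B ⊆ P} := by
  set X : Finset (Set V) := {B ∈ C | B ⊆ P} with hX
  have memX : ∀ {B}, B ∈ X ↔ B ∈ C ∧ B ⊆ P := by simp [hX]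
  let T : Set V → Finset V := fun B => {a ∈ B.toFinset | ∀ D ∈ X, D ≠ B → a ∉ D}
  have hT : ∀ B ∈ X, q + 2 - #X ≤ #(T B) := by
    intro B hB
    -- `T B` consists of the points of `B` on no other block of `X`. Each of the other #X - 1 blocks
    -- removes at most one of the q + 1 points.
    have h1 : #(B.toFinset \ T B) ≤ #(X.erase B) := by
      refine card_le_card_of_forall_subsingleton (fun a D => a ∈ D) ?_ ?_
      · intro a ha
        simp only [T, mem_sdiff, mem_filter, Set.mem_toFinset, not_and, not_forall,
          not_not] at ha
        obtain ⟨D, hD, hne, haD⟩ := ha.2 ha.1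
        exact ⟨D, mem_erase.2 ⟨hne, hD⟩, haD⟩
      · intro D hD a ha b hb
        rw [mem_erase] at hD
        by_contra hab
        simp only [Set.mem_ofPred_eq, mem_sdiff, Set.mem_toFinset] at ha hb
        exact hD.1 (hS.block_eq (hC _ (memX.1 hD.2).1) (hC _ (memX.1 hB).1) hab
          ha.2 hb.2 ha.1.1 hb.1.1)
    have h2 : #(B.toFinset \ T B) + #(T B) = q + 1 := by
      rw [card_sdiff_add_card_eq_card (filter_subset _ _),
        hS.card_toFinset (hC _ (memX.1 hB).1)]
    rw [card_erase_of_mem hB] at h1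
    have := card_pos.2 ⟨B, hB⟩
    omega
  have hdisj : ∀ A ∈ X, ∀ B ∈ X, A ≠ B → Disjoint (T A) (T B) := by
    intro A hA B hB hne
    rw [Finset.disjoint_left]
    intro a haA haB
    simp only [T, mem_filter, Set.mem_toFinset] at haA haB
    exact haA.2 B hB hne.symm haB.1
  calc #X * (q + 2 - #X) = ∑ _B ∈ X, (q + 2 - #X) := by simp
    _ ≤ ∑ B ∈ X, #(T B) := sum_le_sum hT
    _ = #(X.biUnion T) := (card_biUnion hdisj).symm
    _ ≤ #{B ∈ C | ¬ B ⊆ P} := by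
      -- By evenness a point of `T B` lies on a second block of `C`, which cannot be in `X` and so
      -- leaves `P`. Such a block meets `P` in at most one point, so no block is used twice.
      refine card_le_card_of_forall_subsingleton (fun a D => a ∈ D) ?_ ?_
      · intro a ha
        simp only [T, mem_biUnion, mem_filter, Set.mem_toFinset] at ha
        obtain ⟨B, hB, haB, huniq⟩ := ha
        obtain ⟨D, hD, hne, haD⟩ := exists_ne_of_even (heven a) (memX.1 hB).1 haB
        refine ⟨D, mem_filter.2 ⟨hD, fun hDP => huniq D (memX.2 ⟨hD, hDP⟩) hne haD⟩, haD⟩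
      · intro D hD a ha b hb
        rw [mem_filter] at hD
        by_contra hab
        simp only [T, Set.mem_ofPred_eq, mem_biUnion, mem_filter, Set.mem_toFinset] at ha hb
        obtain ⟨⟨A, hA, haA, -⟩, haD⟩ := ha
        obtain ⟨⟨B, hB, hbB, -⟩, hbD⟩ := hb
        exact hD.2 (hP D (hC _ hD.1) a haD b hbD hab ((memX.1 hA).2 haA) ((memX.1 hB).2 hbB))

/-- An even family that is not contained in a subspace has more than `q` blocks outside it. -/
theorem IsSteiner.lt_card_outside (hS : S.IsSteiner (q + 1) v) {C : Finset (Set V)}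
    (hC : ∀ B ∈ C, B ∈ S.blocks) (heven : ∀ a, Even #{B ∈ C | a ∈ B}) {P : Set V}
    (hP : S.IsSubspace P) {L : Set V} (hL : L ∈ C) (hLP : ¬ L ⊆ P) :
    q < #{B ∈ C | ¬ B ⊆ P} := by
  set Y : Finset (Set V) := {B ∈ C | ¬ B ⊆ P} with hY
  have memY : ∀ {B}, B ∈ Y ↔ B ∈ C ∧ ¬ B ⊆ P := by simp [hY]
  have h1 : #{a ∈ L.toFinset | a ∈ P} ≤ 1 := by
    rw [card_le_one]
    intro a ha b hb
    simp only [mem_filter, Set.mem_toFinset] at ha hb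
    by_contra hab
    exact hLP (hP L (hC _ hL) a ha.1 b hb.1 hab ha.2 hb.2)
  -- Each point of `L` off `P` needs another block of `C`, and these are distinct. Counting `L`
  -- itself turns q into q + 1.
  have h2 : #{a ∈ L.toFinset | a ∉ P} ≤ #(Y.erase L) := by
    refine card_le_card_of_forall_subsingleton (fun a D => a ∈ D) ?_ ?_
    · intro a ha
      simp only [mem_filter, Set.mem_toFinset] at ha
      obtain ⟨D, hD, hne, haD⟩ := exists_ne_of_even (heven a) hL ha.1
      exact ⟨D, mem_erase.2 ⟨hne, memY.2 ⟨hD, fun h => ha.2 (h haD)⟩⟩, haD⟩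
    · intro D hD a ha b hb
      rw [mem_erase] at hD
      by_contra hab
      simp only [Set.mem_ofPred_eq, mem_filter, Set.mem_toFinset] at ha hb
      exact hD.1 (hS.block_eq (hC _ (memY.1 hD.2).1) (hC _ hL) hab ha.2 hb.2 ha.1.1 hb.1.1)
  have h3 := card_filter_add_card_filter_not (s := L.toFinset) (fun a => a ∈ P)
  rw [hS.card_toFinset (hC _ hL)] at h3
  have hLY : L ∈ Y := memY.2 ⟨hL, hLP⟩
  rw [card_erase_of_mem hLY] at h2
  have := card_pos.2 ⟨L, hLY⟩
  omega

/-- Double counting of the incidences between the points of a block and a family of blocks that all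
meet it. -/
theorem IsSteiner.sum_degree (hS : S.IsSteiner (q + 1) v) {C : Finset (Set V)}
    (hC : ∀ B ∈ C, B ∈ S.blocks) {D : Set V} (hD : D ∈ S.blocks)
    (hmeet : ∀ B ∈ C, (D ∩ B).Nonempty) :
    ∑ a ∈ D.toFinset, #{B ∈ C | a ∈ B} = #C + if D ∈ C then q else 0 := by
  have h1 : ∑ a ∈ D.toFinset, #{B ∈ C | a ∈ B} = ∑ B ∈ C, #{a ∈ D.toFinset | a ∈ B} :=
    sum_card_bipartiteAbove_eq_sum_card_bipartiteBelow (fun a B => a ∈ B)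
  have h2 : ∀ B ∈ C, #{a ∈ D.toFinset | a ∈ B} = 1 + if D = B then q else 0 := by
    intro B hB
    split_ifs with h
    · subst h
      rw [filter_true_of_mem (by simp), hS.card_toFinset hD, add_comm]
    · obtain ⟨a, haD, haB⟩ := hmeet B hB
      rw [add_zero, card_eq_one]
      refine ⟨a, ?_⟩
      ext b
      simp only [mem_filter, Set.mem_toFinset, mem_singleton]
      refine ⟨fun hb => ?_, fun hb => hb ▸ ⟨haD, haB⟩⟩
      by_contra hab
      exact h (hS.block_eq hD (hC B hB) hab hb.1 haD hb.2 haB)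
  rw [h1, sum_congr rfl h2, sum_add_distrib, sum_ite_eq]
  simp

/-- A nonempty even family of pairwise meeting blocks within a plane has more than `q ^ 2 + q`
blocks, for odd `q`: it consists of all the blocks in the plane. -/
theorem IsSteiner.lt_card_of_subset_plane (hS : S.IsSteiner (q + 1) v) (hq : Odd q)
    {C : Finset (Set V)} (hC : ∀ B ∈ C, B ∈ S.blocks) (heven : ∀ a, Even #{B ∈ C | a ∈ B})
    {P : Set V} (hP : S.IsSubspace P)
    (hmeet : ∀ D ∈ S.blocks, ∀ E ∈ S.blocks, D ⊆ P → E ⊆ P → (D ∩ E).Nonempty)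
    (hCP : ∀ B ∈ C, B ⊆ P) {A : Set V} (hA : A ∈ C) : q ^ 2 + q < #C := by
  have hsum : ∀ D ∈ S.blocks, D ⊆ P →
      ∑ a ∈ D.toFinset, #{B ∈ C | a ∈ B} = #C + if D ∈ C then q else 0 := fun D hD hDP =>
    hS.sum_degree hC hD fun B hB => hmeet D hD B (hC B hB) hDP (hCP B hB)
  have hsumA := hsum A (hC A hA) (hCP A hA)
  rw [if_pos hA] at hsumA
  have hall : ∀ D ∈ S.blocks, D ⊆ P → D ∈ C := by
    intro D hD hDP
    by_contra hDC
    have h1 := hsum D hD hDP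
    rw [if_neg hDC, add_zero] at h1
    have h2 : Even #C := h1 ▸ even_sum _ fun a _ => heven a
    have h3 : Even (#C + q) := hsumA ▸ even_sum _ fun a _ => heven a
    exact Nat.not_even_iff_odd.2 hq ((Nat.even_add.1 h3).1 h2)
  -- Some block `D` of `C` misses `a`. The q + 1 blocks joining `a` to the points of `D` are
  -- distinct and lie in `P`, hence in `C`.
  have hdeg : ∀ a ∈ A.toFinset, q + 1 ≤ #{B ∈ C | a ∈ B} := by
    intro a ha
    have hcard : 1 < #A.toFinset := by
      rw [hS.card_toFinset (hC A hA)]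
      have := hq.pos
      omega
    obtain ⟨b, hb, hba⟩ := exists_mem_ne hcard a
    rw [Set.mem_toFinset] at ha hb
    obtain ⟨D, hD, hDA, hbD⟩ := exists_ne_of_even (heven b) hA hb
    have haD : a ∉ D := fun haD => hDA (hS.block_eq (hC D hD) (hC A hA) hba hbD haD hb ha)
    rw [← hS.card_toFinset (hC D hD)]
    refine card_le_card_of_forall_subsingleton (fun c E => c ∈ E) ?_ ?_
    · intro c hc
      rw [Set.mem_toFinset] at hc
      have hac : a ≠ c := fun h => haD (h ▸ hc)
      obtain ⟨E, ⟨hE, haE, hcE⟩, -⟩ := hS.existsUnique_block a c hac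
      refine ⟨E, mem_filter.2 ⟨hall E hE ?_, haE⟩, hcE⟩
      exact hP E hE a haE c hcE hac (hCP A hA ha) (hCP D hD hc)
    · intro E hE c hc d hd
      rw [mem_filter] at hE
      simp only [Set.mem_ofPred_eq, Set.mem_toFinset] at hc hd
      by_contra hcd
      exact haD (hS.block_eq (hC D hD) (hC E hE.1) hcd hc.1 hd.1 hc.2 hd.2 ▸ hE.2)
  have h := sum_le_sum hdeg
  rw [hsumA, sum_const, hS.card_toFinset (hC A hA), smul_eq_mul] at h
  nlinarith

theorem IsSteiner.lt_card_of_even (hS : S.IsSteiner (q + 1) v) (hq : Odd q) (hq3 : 3 ≤ q)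
    (hplanes : S.HasPlanes) {C : Finset (Set V)} (hC : ∀ B ∈ C, B ∈ S.blocks)
    (heven : ∀ a, Even #{B ∈ C | a ∈ B}) (hne : C.Nonempty) : 2 * q + 1 < #C := by
  obtain ⟨A, hA⟩ := hne
  have hApos : 0 < #A.toFinset := by rw [hS.card_toFinset (hC A hA)]; omega
  obtain ⟨a, ha⟩ := card_pos.1 hApos
  rw [Set.mem_toFinset] at ha
  obtain ⟨B, hB, hBA, haB⟩ := exists_ne_of_even (heven a) hA ha
  obtain ⟨P, hAP, hBP, hP, hmeet⟩ := hplanes A (hC A hA) B (hC B hB) hBA.symm ⟨a, ha, haB⟩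
  by_cases hall : ∀ B ∈ C, B ⊆ P
  · have := hS.lt_card_of_subset_plane hq hC heven hP hmeet hall hA
    nlinarith
  · push Not at hall
    obtain ⟨L, hL, hLP⟩ := hall
    have h1 := hS.lt_card_outside hC heven hP hL hLP
    have h2 := hS.mul_le_card_outside hC heven hP
    have h3 := card_filter_add_card_filter_not (s := C) (fun B => B ⊆ P)
    have h4 : 1 < #{B ∈ C | B ⊆ P} := one_lt_card.2
      ⟨A, by simp [hA, hAP], B, by simp [hB, hBP], hBA.symm⟩
    by_contra hcon
    -- With n blocks inside `P`, more than q outside and at most 2q + 1 in all, n ≤ q. For q = n + k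
    -- the bound n + n(k + 2) ≥ 2q + 2 amounts to (n - 2)(k + 1) ≥ 0.
    obtain ⟨k, hk⟩ : ∃ k, q = #{B ∈ C | B ⊆ P} + k := ⟨q - #{B ∈ C | B ⊆ P}, by omega⟩
    have h5 : q + 2 - #{B ∈ C | B ⊆ P} = k + 2 := by omega
    rw [h5] at h2
    nlinarith

end Finite

theorem IsSteiner.isEvenFree {S : SetSystem V} {q v : ℕ} (hS : S.IsSteiner (q + 1) v) (hq : Odd q) (hq3 : 3 ≤ q)
    (hplanes : S.HasPlanes) : S.IsEvenFree (2 * q + 1) := by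
  have := hS.finite
  have := Fintype.ofFinite V
  rintro i hi hle ⟨W, C, hWC, rfl⟩
  have hfin : C.Finite := Set.toFinite C
  have hdeg : ∀ a, {B | B ∈ C ∧ a ∈ B}.ncard = #{B ∈ hfin.toFinset | a ∈ B} := by
    intro a
    rw [← Set.ncard_coe_finset]
    simp
  have h := hS.lt_card_of_even hq hq3 hplanes (C := hfin.toFinset)
    (fun B hB => hWC.subset_blocks (by simpa using hB)) (fun a => ?_) ?_
  · rw [← Set.ncard_eq_toFinset_card C hfin] at h
    omega
  · rw [← hdeg a]
    -- Evenness is given only on `W`, but a point outside `W` lies on no block of `C`.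
    by_cases ha : a ∈ W
    · exact hWC.even a ha
    · have : {B | B ∈ C ∧ a ∈ B} = ∅ := by
        ext B
        simpa using fun hB haB => ha (hWC.block_subset B hB haB)
      simp [this]
  · rw [Set.Finite.toFinset_nonempty]
    exact Set.nonempty_of_ncard_ne_zero hi.ne'

end SetSystem

/-! ### Lines and planes of the projective geometry -/

namespace Projectivization

variable {F V : Type*} [Field F] [AddCommGroup V] [Module F V]

theorem mk_submodule_le {x : V} (hx : x ≠ 0) {M : Submodule F V} :
    (mk F x hx).submodule ≤ M ↔ x ∈ M := by
  rw [submodule_mk, Submodule.span_singleton_le_iff_mem]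

theorem ncard_submodule_le [Finite F] {M : Submodule F V} (hM : Module.finrank F M = 2) :
    {p : ℙ F V | p.submodule ≤ M}.ncard = Nat.card F + 1 := by
  rw [← card_of_finrank_two F M hM]
  have hrange : {p : ℙ F V | p.submodule ≤ M} =
      Set.range (map M.subtype M.subtype_injective) := by
    ext p
    induction p using ind with | h x hx =>
    rw [Set.mem_ofPred_eq, mk_submodule_le]
    constructor
    · intro h
      exact ⟨mk F ⟨x, h⟩ (by simpa [Subtype.ext_iff] using hx), rfl⟩
    · rintro ⟨y, hy⟩
      induction y using ind with | h y hy0 =>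
      rw [map_mk, mk_eq_mk_iff'] at hy
      obtain ⟨a, ha⟩ := hy
      have hax : a • x ∈ M := ha ▸ y.2
      have ha0 : a ≠ 0 := by
        rintro rfl
        rw [zero_smul] at ha
        exact hy0 (Subtype.ext ha.symm)
      exact (M.smul_mem_iff ha0).1 hax
  rw [hrange, ← Nat.card_coe_set_eq, Nat.card_range_of_injective (map_injective _ _)]

theorem finrank_sup {p r : ℙ F V} (h : p ≠ r) :
    Module.finrank F ↥(p.submodule ⊔ r.submodule) = 2 := by
  have h1 := Submodule.finrank_sup_add_finrank_inf_eq p.submodule r.submodule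
  rw [finrank_submodule, finrank_submodule] at h1
  have h2 : Module.finrank F ↥(p.submodule ⊓ r.submodule) < 1 := by
    rw [← finrank_submodule p]
    refine Submodule.finrank_lt_finrank_of_lt (lt_of_le_of_ne inf_le_left fun h3 => h ?_)
    exact submodule_injective (Submodule.eq_of_le_of_finrank_eq (inf_eq_left.1 h3)
      (by rw [finrank_submodule, finrank_submodule]))
  omega

end Projectivization

open Projectivization Module

section

variable {F : Type*} [Field F] {m : ℕ}

theorem eq_sup_of_submodule_le {M : Submodule F (Fin (m + 1) → F)} (hM : finrank F M = 2)
    {p r : ℙ F (Fin (m + 1) → F)} (h : p ≠ r) (hp : p.submodule ≤ M) (hr : r.submodule ≤ M) :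
    p.submodule ⊔ r.submodule = M :=
  Submodule.eq_of_le_of_finrank_eq (sup_le hp hr) (by rw [finrank_sup h, hM])

theorem projectiveGeometry_isSteiner [Finite F] :
    (projectiveGeometry F m).IsSteiner (Nat.card F + 1)
      ((Nat.card F ^ (m + 1) - 1) / (Nat.card F - 1)) where
  finite := inferInstance
  card_points := by simp [card'', Nat.card_fun]
  card_block := by
    rintro B ⟨M, hM, rfl⟩
    exact ncard_submodule_le hM
  existsUnique_block := by
    intro a b hab
    refine ⟨{p | p.submodule ≤ a.submodule ⊔ b.submodule},
      ⟨⟨_, finrank_sup hab, rfl⟩, ?_, ?_⟩, ?_⟩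
    · exact le_sup_left (a := a.submodule)
    · exact le_sup_right (a := a.submodule)
    · rintro B ⟨⟨M, hM, rfl⟩, ha, hb⟩
      rw [eq_sup_of_submodule_le hM hab ha hb]

/-- The span of two meeting lines has rank at most 3, and two subspaces of rank 2 inside it
intersect nontrivially by the dimension formula. -/
theorem projectiveGeometry_hasPlanes : (projectiveGeometry F m).HasPlanes := by
  rintro A ⟨M, hM, rfl⟩ B ⟨N, hN, rfl⟩ - ⟨p, hpM, hpN⟩
  have hsup : finrank F ↥(M ⊔ N) ≤ 3 := by
    have h1 := Submodule.finrank_sup_add_finrank_inf_eq M N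
    have h2 := Submodule.finrank_mono (le_inf hpM hpN)
    rw [finrank_submodule] at h2
    omega
  refine ⟨{p | p.submodule ≤ M ⊔ N}, fun a (ha : a.submodule ≤ M) => ha.trans le_sup_left,
    fun a (ha : a.submodule ≤ N) => ha.trans le_sup_right, ?_, ?_⟩
  · rintro D ⟨K, hK, rfl⟩ a ha b hb hab haP hbP c (hc : c.submodule ≤ K)
    refine hc.trans (b := K) (c := M ⊔ N) ?_
    rw [← eq_sup_of_submodule_le hK hab ha hb]
    exact sup_le haP hbP
  · have key : ∀ K : Submodule F (Fin (m + 1) → F), {p : ℙ F _ | p.submodule ≤ K} ⊆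
        {p | p.submodule ≤ M ⊔ N} → K ≤ M ⊔ N := by
      intro K hK x hx
      by_cases hx0 : x = 0
      · simp [hx0]
      · exact (mk_submodule_le hx0).1 (hK ((mk_submodule_le hx0).2 hx))
    rintro D ⟨K, hK, rfl⟩ E ⟨L, hL, rfl⟩ hD hE
    have h1 := Submodule.finrank_sup_add_finrank_inf_eq K L
    have h2 := Submodule.finrank_mono (sup_le (key K hD) (key L hE))
    have h3 : K ⊓ L ≠ ⊥ := by
      intro h
      rw [h, finrank_bot] at h1
      omega
    obtain ⟨x, hx, hx0⟩ := Submodule.exists_mem_ne_zero_of_ne_bot h3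
    exact ⟨mk F x hx0, (mk_submodule_le hx0).2 hx.1, (mk_submodule_le hx0).2 hx.2⟩

end

/-! ### Transport along isomorphisms -/

namespace SetSystem

variable {V W : Type*} {S : SetSystem V} {T : SetSystem W} {e : V ≃ W}

theorem IsIso.image_mem_iff (h : S.IsIso T e) {B : Set V} :
    e '' B ∈ T.blocks ↔ B ∈ S.blocks := by
  rw [← h]
  constructor
  · rintro ⟨A, hA, hAB⟩
    rwa [← e.injective.image_injective hAB]
  · exact fun hB => ⟨B, hB, rfl⟩

theorem IsIso.isSteiner (h : S.IsIso T e) {k v : ℕ} (hT : T.IsSteiner k v) :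
    S.IsSteiner k v where
  finite := have := hT.finite; Finite.of_equiv W e.symm
  card_points := by rw [Nat.card_congr e, hT.card_points]
  card_block B hB := by
    rw [← hT.card_block _ (h.image_mem_iff.2 hB), Set.ncard_image_of_injective _ e.injective]
  existsUnique_block a b hab := by
    obtain ⟨B, ⟨hB, ha, hb⟩, huniq⟩ := hT.existsUnique_block (e a) (e b) (e.injective.ne hab)
    refine ⟨e ⁻¹' B, ⟨h.image_mem_iff.1 ?_, ha, hb⟩, ?_⟩
    · rwa [e.image_preimage]
    · rintro A ⟨hA, haA, hbA⟩
      rw [← huniq (e '' A) ⟨h.image_mem_iff.2 hA, Set.mem_image_of_mem _ haA,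
        Set.mem_image_of_mem _ hbA⟩, e.preimage_image]

theorem IsIso.isEvenFree (h : S.IsIso T e) {r : ℕ} (hT : T.IsEvenFree r) : S.IsEvenFree r := by
  rintro i hi hle ⟨P, C, hPC, hcard⟩
  have hinj : Function.Injective (fun B : Set V => e '' B) := e.injective.image_injective
  refine hT i hi hle ⟨e '' P, (fun B => e '' B) '' C, ⟨?_, ?_, ?_⟩, ?_⟩
  · rintro _ ⟨B, hB, rfl⟩
    exact h.image_mem_iff.2 (hPC.subset_blocks hB)
  · rintro _ ⟨B, hB, rfl⟩
    exact Set.image_mono (hPC.block_subset B hB)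
  · rintro _ ⟨a, ha, rfl⟩
    have : {B | B ∈ (fun B => e '' B) '' C ∧ e a ∈ B} =
        (fun B => e '' B) '' {B | B ∈ C ∧ a ∈ B} := by
      ext B
      constructor
      · rintro ⟨⟨A, hA, rfl⟩, haA⟩
        exact ⟨A, ⟨hA, by simpa using haA⟩, rfl⟩
      · rintro ⟨A, ⟨hA, haA⟩, rfl⟩
        exact ⟨⟨A, hA, rfl⟩, Set.mem_image_of_mem _ haA⟩
    rw [this, Set.ncard_image_of_injective _ hinj]
    exact hPC.even a ha
  · rw [Set.ncard_image_of_injective _ hinj, hcard]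

end SetSystem

/-! ### The Singer cycle -/

/-- The exponents `i` modulo `v` such that `ζ ^ i` lies in a given two-dimensional subspace of `K`
over the subfield of elements with `a ^ q = a` form a block. -/
def singerSetSystem {K : Type*} [Field K] (ζ : K) (q v : ℕ) : SetSystem (ZMod v) where
  blocks := {L | ∃ M : AddSubgroup K, Nat.card M = q ^ 2 ∧
    (∀ a : K, a ^ q = a → ∀ x ∈ M, a * x ∈ M) ∧ L = {i | ζ ^ i.val ∈ M}}

/-- A permutation that a bijection with `ℤ/vℤ` turns into the shift is a single cycle. -/
theorem isCycleOn_univ_of_shift {α : Type*} {v : ℕ} [NeZero v] (e : ZMod v ≃ α)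
    (f : Equiv.Perm α) (h : ∀ i, e (i + 1) = f (e i)) : f.IsCycleOn Set.univ := by
  refine ⟨Set.bijOn_univ.2 f.bijective, fun x _ y _ => ?_⟩
  have hpow : ∀ (n : ℕ) (i : ZMod v), (f ^ n) (e i) = e (i + n) := by
    intro n
    induction n with
    | zero => simp
    | succ n ih =>
      intro i
      rw [pow_succ', Equiv.Perm.mul_apply, ih, ← h, Nat.cast_succ, add_assoc]
  refine ⟨((e.symm y - e.symm x).val : ℕ), ?_⟩
  rw [zpow_natCast]
  have := hpow (e.symm y - e.symm x).val (e.symm x)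
  simpa using this

section

variable {F K : Type*} [Field F] [Finite F] [Field K] [Algebra F K]

/-- X^q - X has at most q roots, and the image of `F` already supplies q of them. -/
theorem pow_card_eq_self_iff {a : K} :
    a ^ Nat.card F = a ↔ ∃ c : F, algebraMap F K c = a := by
  have := Fintype.ofFinite F
  constructor
  · intro ha
    have hinj := (algebraMap F K).injective
    have hne : (Polynomial.X ^ Nat.card F - Polynomial.X : Polynomial K) ≠ 0 :=
      FiniteField.X_pow_card_sub_X_ne_zero K Finite.one_lt_card
    classical
    have hsub : Finset.univ.map ⟨algebraMap F K, hinj⟩ ⊆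
        (Polynomial.X ^ Nat.card F - Polynomial.X : Polynomial K).roots.toFinset := by
      intro x hx
      simp only [Finset.mem_map, Finset.mem_univ, true_and, Function.Embedding.coeFn_mk] at hx
      obtain ⟨c, rfl⟩ := hx
      rw [Multiset.mem_toFinset, Polynomial.mem_roots hne]
      simp [← map_pow, FiniteField.pow_card c]
    have heq := Finset.eq_of_subset_of_card_le hsub (by
      refine (Multiset.toFinset_card_le _).trans ((Polynomial.card_roots' _).trans ?_)
      rw [FiniteField.X_pow_card_sub_X_natDegree_eq K Finite.one_lt_card]
      simp)
    have hmem : a ∈ (Polynomial.X ^ Nat.card F - Polynomial.X : Polynomial K).roots.toFinset := by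
      rw [Multiset.mem_toFinset, Polynomial.mem_roots hne]
      simpa [sub_eq_zero] using ha
    rw [← heq] at hmem
    simpa using hmem
  · rintro ⟨c, rfl⟩
    rw [← map_pow, Nat.card_eq_fintype_card, FiniteField.pow_card]

/-- Multiplication by a generator `ζ` of the multiplicative group of `K = F ^ (m + 1)` is a Singer
cycle, and the resulting cyclic labelling of `PG(m, F)` carries the lines to the blocks of
`singerSetSystem`. -/
theorem exists_singerCycle [Finite K] {m q v : ℕ} (hF : Nat.card F = q)
    (hK : Nat.card K = q ^ (m + 1)) (hv : v = (q ^ (m + 1) - 1) / (q - 1)) (ζ : Kˣ)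
    (hζ : ∀ x : Kˣ, x ∈ Subgroup.zpowers ζ) :
    ∃ (g : LinearMap.GeneralLinearGroup F (Fin (m + 1) → F))
      (e : ZMod v ≃ ℙ F (Fin (m + 1) → F)), IsSingerCycle g ∧
      (singerSetSystem (ζ : K) q v).IsIso (projectiveGeometry F m) e ∧
      ∀ i : ZMod v, e (i + 1) = g • e i := by
  have hq1 : 1 < q := hF ▸ Finite.one_lt_card
  have hpg := projectiveGeometry_isSteiner (F := F) (m := m)
  have hcard : Nat.card (ℙ F (Fin (m + 1) → F)) = v := by rw [hpg.card_points, hF, hv]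
  have : NeZero v := ⟨by rw [← hcard]; exact Nat.card_pos.ne'⟩
  have hmul : v * (q - 1) = q ^ (m + 1) - 1 := by
    rw [← hcard, ← hF, ← Projectivization.card]
    simp [Nat.card_fun]
  have hrank : finrank F K = m + 1 := by
    have h := Module.natCard_eq_pow_finrank (K := F) (V := K)
    rw [hK, hF] at h
    exact (Nat.pow_right_injective hq1 h).symm
  have b : K ≃ₗ[F] (Fin (m + 1) → F) := LinearEquiv.ofFinrankEq _ _ (by simpa using hrank)
  have hne : ∀ n : ℕ, b ((ζ : K) ^ n) ≠ 0 := fun n => by simp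
  let E : ℕ → ℙ F (Fin (m + 1) → F) := fun n => mk F (b ((ζ : K) ^ n)) (hne n)
  -- Since v(q - 1) = |Kˣ|, the element ζ^v is fixed by the q-th power map, so it is a scalar from
  -- `F` and does not move points.
  have hperiod : Function.Periodic E v := by
    intro n
    obtain ⟨c, hc⟩ : ∃ c : F, algebraMap F K c = (ζ : K) ^ v := by
      rw [← pow_card_eq_self_iff, hF]
      have h1 : (ζ : K) ^ (v * (q - 1)) = 1 := by
        have h := pow_card_eq_one' (x := ζ)
        rw [Nat.card_units, hK] at h
        rw [hmul, ← Units.val_pow_eq_pow_val, h, Units.val_one]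
      rw [← pow_mul, show v * q = v * (q - 1) + v by
        obtain ⟨k, rfl⟩ : ∃ k, q = k + 1 := ⟨q - 1, by omega⟩
        simp [mul_add], pow_add, h1, one_mul]
    refine (mk_eq_mk_iff' F _ _ _ _).2 ⟨c, ?_⟩
    rw [← map_smul, Algebra.smul_def, hc, pow_add, mul_comm]
  have hval : ∀ n : ℕ, E (n : ZMod v).val = E n := fun n => by
    rw [ZMod.val_natCast, hperiod.map_mod_nat]
  have hsurj : Function.Surjective fun i : ZMod v => E i.val := by
    intro p
    induction p using ind with | h x hx =>
    have hx' : b.symm x ≠ 0 := by simpa using hx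
    obtain ⟨n, hn⟩ := (mem_powers_iff_mem_zpowers (x := ζ)).2 (hζ (Units.mk0 _ hx'))
    refine ⟨n, (hval n).trans ?_⟩
    have hn' : (ζ : K) ^ n = b.symm x := by simpa using congrArg Units.val hn
    simp only [E, hn', LinearEquiv.apply_symm_apply]
  have hbij : Function.Bijective fun i : ZMod v => E i.val :=
    hsurj.bijective_of_nat_card_le (by rw [hcard, Nat.card_zmod])
  let e : ZMod v ≃ ℙ F (Fin (m + 1) → F) := Equiv.ofBijective _ hbij
  have he : ∀ i, e i = E i.val := fun i => rfl
  let g : LinearMap.GeneralLinearGroup F (Fin (m + 1) → F) :=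
    LinearMap.GeneralLinearGroup.ofLinearEquiv
      (b.symm ≪≫ₗ DistribMulAction.toLinearEquiv F K ζ ≪≫ₗ b)
  have hshift : ∀ i : ZMod v, e (i + 1) = g • e i := by
    intro i
    have h1 : e (i + 1) = E (i.val + 1) := by
      rw [he, ← hval (i.val + 1), Nat.cast_succ, ZMod.natCast_zmod_val]
    rw [h1, he, Projectivization.smul_mk]
    simp only [E, g]
    congr 1
    simp [pow_succ', Units.smul_def]
  have himage : ∀ N : Submodule F K, e '' {i | (ζ : K) ^ i.val ∈ N} =
      {p | p.submodule ≤ N.map (b : K →ₗ[F] (Fin (m + 1) → F))} := by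
    intro N
    ext p
    obtain ⟨i, rfl⟩ := e.surjective p
    rw [e.injective.mem_set_image, Set.mem_ofPred_eq, Set.mem_ofPred_eq, he,
      Projectivization.mk_submodule_le]
    simp
  refine ⟨g, e, isCycleOn_univ_of_shift e _ hshift, ?_, hshift⟩
  ext L
  constructor
  · rintro ⟨B, ⟨M, hM, hclosed, rfl⟩, rfl⟩
    let N : Submodule F K :=
      { M with
        smul_mem' := fun c x hx => by
          rw [Algebra.smul_def]
          exact hclosed _ (by rw [← hF]; exact pow_card_eq_self_iff.2 ⟨c, rfl⟩) x hx }
    refine ⟨N.map (b : K →ₗ[F] (Fin (m + 1) → F)), ?_, himage N⟩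
    rw [LinearEquiv.finrank_map_eq]
    have h := Module.natCard_eq_pow_finrank (K := F) (V := N)
    rw [hF, show Nat.card N = q ^ 2 from hM] at h
    exact (Nat.pow_right_injective hq1 h).symm
  · rintro ⟨N, hN, rfl⟩
    let N' : Submodule F K := N.comap (b : K →ₗ[F] (Fin (m + 1) → F))
    have hN' : N'.map (b : K →ₗ[F] (Fin (m + 1) → F)) = N :=
      Submodule.map_comap_eq_of_surjective b.surjective N
    have hrank' : finrank F N' = 2 := by
      rw [← hN, ← hN', LinearEquiv.finrank_map_eq]
    refine ⟨_, ⟨N'.toAddSubgroup, ?_, ?_, rfl⟩, ?_⟩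
    · have h := Module.natCard_eq_pow_finrank (K := F) (V := N')
      rwa [hF, hrank'] at h
    · intro a ha x hx
      obtain ⟨c, rfl⟩ := pow_card_eq_self_iff.1 (hF.symm ▸ ha)
      rw [← Algebra.smul_def]
      exact N'.smul_mem c hx
    · rw [← hN']
      exact himage N'

end

set_option synthInstance.maxHeartbeats 200000 in
/-- A set system on `ℤ/vℤ` is cyclic if the shift is induced by an invertible linear map of a
projective geometry isomorphic to it. -/
theorem SetSystem.IsIso.isCyclic {F : Type*} [Field F] {m v : ℕ} {S : SetSystem (ZMod v)}
    {e : ZMod v ≃ ℙ F (Fin (m + 1) → F)} (h : S.IsIso (projectiveGeometry F m) e)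
    (g : LinearMap.GeneralLinearGroup F (Fin (m + 1) → F)) (hg : ∀ i, e (i + 1) = g • e i) :
    S.IsCyclic := by
  intro B hB
  rw [← h.image_mem_iff] at hB ⊢
  obtain ⟨M, hM, hBM⟩ := hB
  refine ⟨M.map (g.toLinearEquiv : (Fin (m + 1) → F) →ₗ[F] (Fin (m + 1) → F)), ?_, ?_⟩
  · rw [LinearEquiv.finrank_map_eq, hM]
  · have h1 : e '' ((fun x => x + 1) '' B) = (fun p => g • p) '' (e '' B) := by
      simp only [Set.image_image, hg]
    rw [h1, hBM]
    ext p
    obtain ⟨r, rfl⟩ := MulAction.surjective g p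
    rw [(MulAction.injective g).mem_set_image]
    induction r using Projectivization.ind with | h x hx =>
    rw [Set.mem_ofPred_eq, Set.mem_ofPred_eq]
    beta_reduce
    rw [Projectivization.smul_mk,
      Projectivization.mk_submodule_le, Projectivization.mk_submodule_le]
    constructor
    · exact fun hxM => ⟨x, hxM, rfl⟩
    · rintro ⟨y, hy, hyx⟩
      rwa [← (g.toLinearEquiv.injective hyx : y = x)]

/-! ### One design for all fields of order q -/

theorem exists_ringHom_galoisField {p n k : ℕ} [Fact p.Prime] (hn : n ≠ 0) (hk : k ≠ 0)
    {F : Type*} [Field F] [Finite F] (hF : Nat.card F = p ^ n) :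
    Nonempty (F →+* GaloisField p (n * k)) := by
  have : CharP F p := by
    have := Fintype.ofFinite F
    obtain ⟨r, hr⟩ := CharP.exists F
    obtain ⟨j, hp, hj⟩ := FiniteField.card F r
    rw [← Nat.card_eq_fintype_card, hF] at hj
    have : p ∣ r := (Fact.out : p.Prime).dvd_of_dvd_pow (hj ▸ dvd_pow_self p hn)
    rwa [(Nat.prime_dvd_prime_iff_eq Fact.out hp).1 this]
  let : Algebra (ZMod p) F := ZMod.algebra F p
  have hfin : finrank (ZMod p) F = n := by
    have h := FiniteField.pow_finrank_eq_natCard p F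
    rw [hF] at h
    exact Nat.pow_right_injective (Fact.out : p.Prime).two_le h
  obtain ⟨f⟩ := FiniteField.nonempty_algHom_of_finrank_dvd (F := ZMod p) (K := F)
    (L := GaloisField p (n * k))
    (by rw [hfin, GaloisField.finrank p (mul_ne_zero hn hk)]; exact dvd_mul_right _ _)
  exact ⟨f.toRingHom⟩

theorem proposition2p7 (m q : ℕ) (hm : 3 ≤ m) (hq : IsPrimePow q) (hodd : Odd q) :
    ∃ S : SetSystem (ZMod ((q ^ (m + 1) - 1) / (q - 1))),
      S.IsSteiner (q + 1) ((q ^ (m + 1) - 1) / (q - 1)) ∧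
      S.IsEvenFree (2 * q + 1) ∧
      S.IsCyclic ∧
      ∀ (F : Type*) [Field F] [Finite F], Nat.card F = q →
        ∃ (g : LinearMap.GeneralLinearGroup F (Fin (m + 1) → F))
          (e : ZMod ((q ^ (m + 1) - 1) / (q - 1)) ≃ ℙ F (Fin (m + 1) → F)),
          IsSingerCycle g ∧
          S.IsIso (projectiveGeometry F m) e ∧
          ∀ i : ZMod ((q ^ (m + 1) - 1) / (q - 1)), e (i + 1) = g • e i := by
  have hq3 : 3 ≤ q := by
    have := hq.one_lt
    rcases hodd with ⟨r, rfl⟩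
    omega
  obtain ⟨p, n, hp, hn, rfl⟩ := (isPrimePow_nat_iff q).1 hq
  have : Fact p.Prime := ⟨hp⟩
  have hK : Nat.card (GaloisField p (n * (m + 1))) = (p ^ n) ^ (m + 1) := by
    rw [GaloisField.card p _ (mul_ne_zero hn.ne' m.succ_ne_zero), pow_mul]
  obtain ⟨ζ, hζ⟩ := IsCyclic.exists_generator (α := (GaloisField p (n * (m + 1)))ˣ)
  have hF₀ : Nat.card (GaloisField p n) = p ^ n := GaloisField.card p n hn.ne'
  -- One model of the field of order q suffices to prove the properties of the design. Its embedding
  -- is needed only here, as the blocks do not depend on it.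
  obtain ⟨g, e, -, hiso, hg⟩ :=
    letI := (exists_ringHom_galoisField hn.ne' m.succ_ne_zero hF₀).some.toAlgebra
    exists_singerCycle hF₀ hK rfl ζ hζ
  have hsteiner := projectiveGeometry_isSteiner (F := GaloisField p n) (m := m)
  rw [hF₀] at hsteiner
  refine ⟨singerSetSystem (ζ : GaloisField p (n * (m + 1))) (p ^ n) _, hiso.isSteiner hsteiner,
    hiso.isEvenFree (hsteiner.isEvenFree hodd hq3 projectiveGeometry_hasPlanes),
    hiso.isCyclic g hg, fun F _ _ hF => ?_⟩
  let := (exists_ringHom_galoisField hn.ne' m.succ_ne_zero hF).some.toAlgebra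
  exact exists_singerCycle hF hK rfl ζ hζ
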